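/- **Setting.** Let $n,m\ge 1$. An instance of uniform machine scheduling ($Qm||C_{\max}$) consists of job lengths $p_1,\dots,p_n\in\mathbb N$ and machine speeds $s_1,\dots,s_m\in\mathbb N_{>0}$ such that all processing times $p_{j,i}=p_j/s_i$ are natural numbers ($0\in\mathbb N$). A schedule assigns each job to a machine; its makespan is the largest total processing time on a machine. For a set $U$ of jobs, overheads $t\in\mathbb N^m$ and $T\in\mathbb N$, let $\mathrm{LP}(U,t,T)$ be the polyhedron of all $(x_{j,i})$, indexed by the pairs with $j\in U$ and $p_{j,i}\le T$, such that $x\ge 0$, $\sum_{i:\,p_{j,i}\le T}x_{j,i}=1$ for $j\in U$, and $\sum_{j\in U:\,p_{j,i}\le T}p_{j,i}x_{j,i}\le T-t_i$ for all machines $i$. A job is fractional in $x$ if one of its coordinates is neither $0$ nor $1$. **The algorithm $A^{\text{sim-prof}}_\varepsilon$.** Number the jobs so that $p_1\ge\dots\ge p_n$. A node $v$ of depth $d$ of the branching tree fixes each of the jobs $1,\dots,d$ on a machine; $t_v$ is the vector of the resulting machine loads, $LB(v)$ is the smallest integer $T$ for which $\mathrm{LP}(\{d+1,\dots,n\},t_v,T)$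 is non-empty, and a vertex at $v$ is a vertex of this polyhedron for $T=LB(v)$. The profile of $v$ is $\Pi(v)=t_v/LB(\text{root})$, and two profiles are $\varepsilon$-similar if they differ by at most $\varepsilon/n$ in every coordinate. At the start the root is the only active node and the only node of the tree. The algorithm repeatedly selects an active node $v$ with the smallest $LB(v)$ and processes it, as follows. 1. It finds a vertex $x$ at $v$. If $x$ is integral, the algorithm records the schedule given by $x$ and the fixed jobs, and stops. 2. If the longest unfixed job $d+1$ is not fractional in $x$ and there is a vertex at $v$ in which it is fractional, $x$ is replaced by such a vertex. 3. It records the schedule in which fixed jobs and integral jobs of $x$ stay where they are and the fractional jobs are assigned, by an injection into the machines, to machines $i$ with $x_{j,i}\neq 0$. 4. $v$ ceases to be active, and its $m$ children, which fix job $d+1$ on machine $1,\dots,m$, are examined in this order. A child $u$ is discarded if a schedule of makespan smaller than $LB(u)$ has been recorded, or $\max_i\Pi(u)_i>2(1+\varepsilon)^2$, or a node of the same depth already in the tree has a profile $\varepsilon$-similar to $\Pi(u)$. Otherwise $u$ is added to the tree and becomes active. The algorithm also stops as soon as no active node is left, or the best recorded makespan is at most $1+\varepsilon$ times the smallest $LB$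 of an active node. It returns the best recorded schedule. The choices left open (order of jobs of equal length, ties in the selection, the vertices, the injection) are arbitrary. **Theorem.** For every $\varepsilon>0$ and every instance, and however these choices are made, $A^{\text{sim-prof}}_\varepsilon$ can always carry out its next step until it stops, it stops after processing at most $$n\cdot\left(\frac{3n(1+\varepsilon)^2}{\varepsilon}\right)^m$$ nodes of the branching tree, and it returns a schedule whose makespan is at most $(1+\varepsilon)^2$ times the minimum makespan. -/

import Mathlib

namespace SimProf

noncomputable section

/-- An instance of uniform machine scheduling: `n` jobs with lengths `p j`, `m` machines with
speeds `s i`, such that every processing time `p j / s i` is a natural number. -/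
structure UniformInstance (n m : ℕ) where
  p : Fin n → ℕ
  s : Fin m → ℕ
  s_pos : ∀ i, 0 < s i
  dvd : ∀ j i, s i ∣ p j

/-- A (complete) schedule assigns a machine to every job. -/
abbrev Schedule (n m : ℕ) := Fin n → Fin m

/-- A node of the branching tree over an instance whose jobs are numbered by decreasing length:
the list `[i₀, …, i_{d-1}]` fixes job `k` on machine `i_k` for all `k < d`; its depth is `d`. -/
abbrev Node (m : ℕ) := List (Fin m)

namespace UniformInstance

variable {n m : ℕ}

/-- Processing time of job `j` on machine `i` (the division is exact). -/
def time (I : UniformInstance n m) (j : Fin n) (i : Fin m) : ℕ := I.p j / I.s i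

/-- The same instance with the jobs renumbered: the new job `k` is the old job `σ k`. -/
def reorder (I : UniformInstance n m) (σ : Equiv.Perm (Fin n)) : UniformInstance n m where
  p := I.p ∘ σ
  s := I.s
  s_pos := I.s_pos
  dvd := fun j i => I.dvd (σ j) i

/-- Completion time of machine `i` in the schedule `S`. -/
def completion (I : UniformInstance n m) (S : Schedule n m) (i : Fin m) : ℕ :=
  ∑ j with S j = i, I.time j i

def makespan (I : UniformInstance n m) (S : Schedule n m) : ℕ :=
  Finset.univ.sup (I.completion S)

/-- The polyhedron of the parametric relaxation with job set `U`, overheads `t` and guess `T`: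
only pairs `(j, i)` with `j ∈ U` and processing time at most `T` carry a variable. It is written
in `ℝ^(n × m)` with all the other coordinates equal to `0`. -/
def partialLP (I : UniformInstance n m) (U : Finset (Fin n)) (t : Fin m → ℕ) (T : ℕ) :
    Set (Fin n → Fin m → ℝ) :=
  {x | (∀ j ∈ U, ∑ i with I.time j i ≤ T, x j i = 1) ∧
       (∀ i, ∑ j ∈ U with I.time j i ≤ T, (I.time j i : ℝ) * x j i ≤ (T : ℝ) - (t i : ℝ)) ∧
       (∀ j i, j ∈ U → I.time j i ≤ T → 0 ≤ x j i) ∧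
       (∀ j i, ¬ (j ∈ U ∧ I.time j i ≤ T) → x j i = 0)}

/-- The jobs that are not fixed at the node `v`. -/
def unfixed (_I : UniformInstance n m) (v : Node m) : Finset (Fin n) :=
  {j | v.length ≤ (j : ℕ)}

/-- The overhead of machine `i` at the node `v`: total time of the jobs fixed on `i`. -/
def overhead (I : UniformInstance n m) (v : Node m) (i : Fin m) : ℕ :=
  ∑ j : Fin n, if v[(j : ℕ)]? = some i then I.time j i else 0

/-- The local lower bound of a node: the smallest integer `T` for which the relaxation of its
sub-problem is feasible. -/
def LB (I : UniformInstance n m) (v : Node m) : ℕ :=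
  sInf {T : ℕ | (I.partialLP (I.unfixed v) (I.overhead v) T).Nonempty}

/-- The vertices of the relaxation at the node `v`, for the smallest feasible `T`. -/
def vertices (I : UniformInstance n m) (v : Node m) : Set (Fin n → Fin m → ℝ) :=
  (I.partialLP (I.unfixed v) (I.overhead v) (I.LB v)).extremePoints ℝ

/-- The profile of a node in the normalized instance, in which all the processing times are
divided by the lower bound of the root. The other comparisons that the algorithm makes are
invariant under this normalization and are made below in the original units. -/
def profile (I : UniformInstance n m) (v : Node m) (i : Fin m) : ℝ :=
  (I.overhead v i : ℝ) / (I.LB [] : ℝ)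

/-- The profiles of `u` and `v` are `ε`-similar. -/
def Similar (I : UniformInstance n m) (ε : ℝ) (u v : Node m) : Prop :=
  ∀ i, |I.profile u i - I.profile v i| ≤ ε / (n : ℝ)

end UniformInstance

variable {n m : ℕ}

/-- Job `j` is fractional in `x`. -/
def IsFractional (x : Fin n → Fin m → ℝ) (j : Fin n) : Prop :=
  ∃ i, x j i ≠ 0 ∧ x j i ≠ 1

/-- The longest job not fixed at `v` (the one with number `v.length`) is fractional in `x`. -/
def LongestFractional (v : Node m) (x : Fin n → Fin m → ℝ) : Prop :=
  ∃ j : Fin n, (j : ℕ) = v.length ∧ IsFractional x j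

/-- `S` is obtained at the node `v` from the vertex `x`: fixed jobs stay where they are fixed,
integral jobs follow `x`, and the fractional jobs are matched injectively to machines
that process a positive part of them in `x`. -/
def IsRounding (v : Node m) (x : Fin n → Fin m → ℝ) (S : Schedule n m) : Prop :=
  (∀ j : Fin n, (j : ℕ) < v.length → v[(j : ℕ)]? = some (S j)) ∧
  (∀ j : Fin n, v.length ≤ (j : ℕ) → ¬ IsFractional x j → x j (S j) = 1) ∧
  (∀ j : Fin n, IsFractional x j → x j (S j) ≠ 0) ∧
  Set.InjOn S {j | IsFractional x j}

/-- State of the algorithm: the active nodes, the nodes kept in the branching tree so far (their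
profiles form the list of profiles), the best schedule found so far, and a flag telling
that an integral vertex has been found. -/
structure State (n m : ℕ) where
  active : Finset (Node m)
  tree : Finset (Node m)
  best : Option (Schedule n m)
  halted : Prop

/-- Initially the root is the only node and no schedule is known. -/
def initial (n m : ℕ) : State n m where
  active := {[]}
  tree := {[]}
  best := none
  halted := False

/-- The better one of the incumbent (if there is one) and a new schedule. -/
def better (I : UniformInstance n m) (b : Option (Schedule n m)) (S : Schedule n m) :
    Schedule n m :=
  match b with
  | none => S
  | some S₀ => if I.makespan S < I.makespan S₀ then S else S₀

/-- The new node `u` is discarded: a schedule better than its lower bound is known (`B` is the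
best known schedule), its profile leaves the cube, or its profile is similar to that of a node
of the same depth that has been kept before. -/
def Discarded (I : UniformInstance n m) (ε : ℝ) (B : Schedule n m) (tree : Finset (Node m))
    (u : Node m) : Prop :=
  I.makespan B < I.LB u ∨
  (∃ i, 2 * (1 + ε) ^ 2 < I.profile u i) ∨
  (∃ w ∈ tree, w.length = u.length ∧ I.Similar ε w u)

open Classical in
/-- Branching at `v`: the children, in which the longest unfixed job is fixed on machine
`0, 1, …, m - 1`, are examined one after the other, and those that are not discarded are added
to the active nodes and to the tree; `v` is no longer active. -/
def expand (I : UniformInstance n m) (ε : ℝ) (B : Schedule n m) (v : Node m)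
    (active tree : Finset (Node m)) : Finset (Node m) × Finset (Node m) :=
  (List.finRange m).foldl
    (fun q i => if Discarded I ε B q.2 (v ++ [i]) then q
      else (insert (v ++ [i]) q.1, insert (v ++ [i]) q.2))
    (active.erase v, tree)

/-- The algorithm stops when an integral vertex has been found, when no active node is left, or
when the best makespan is at most `1 + ε` times the lowest lower bound of the active nodes. -/
def Terminated (I : UniformInstance n m) (ε : ℝ) (s : State n m) : Prop :=
  s.halted ∨ s.active = ∅ ∨
  ∃ S, s.best = some S ∧ ∀ v ∈ s.active, (I.makespan S : ℝ) ≤ (1 + ε) * (I.LB v : ℝ)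

/-- Best-first selection: `v` is an active node with the lowest lower bound. -/
def Selected (I : UniformInstance n m) (s : State n m) (v : Node m) : Prop :=
  v ∈ s.active ∧ ∀ w ∈ s.active, I.LB v ≤ I.LB w

/-- Processing one node `v`. A vertex `x` of the relaxation at `v` is found. If it is integral,
the algorithm halts. Otherwise it passes to a vertex `y` in which the longest unfixed job is
fractional (`y = x` if this holds for `x` or if there is no such vertex), rounds `y` to a
schedule, and branches on the longest unfixed job. The choices of `v`, `x`, `y`, and of the
rounding are arbitrary. -/
inductive Step (I : UniformInstance n m) (ε : ℝ) : State n m → State n m → Prop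
  | integral (s : State n m) (v : Node m) (x : Fin n → Fin m → ℝ) (S : Schedule n m)
      (running : ¬ Terminated I ε s) (selected : Selected I s v)
      (vertex : x ∈ I.vertices v) (integ : ∀ j, ¬ IsFractional x j)
      (rounding : IsRounding v x S) :
      Step I ε s
        { active := s.active.erase v
          tree := s.tree
          best := some (better I s.best S)
          halted := True }
  | branch (s : State n m) (v : Node m) (x y : Fin n → Fin m → ℝ) (S : Schedule n m)
      (running : ¬ Terminated I ε s) (selected : Selected I s v)
      (vertex : x ∈ I.vertices v) (fractional : ∃ j, IsFractional x j)
      (vertex' : y ∈ I.vertices v)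
      (keep : LongestFractional v x → y = x)
      (longest : LongestFractional v y ∨ (y = x ∧ ∀ z ∈ I.vertices v, ¬ LongestFractional v z))
      (rounding : IsRounding v y S) :
      Step I ε s
        { active := (expand I ε (better I s.best S) v s.active s.tree).1
          tree := (expand I ε (better I s.best S) v s.active s.tree).2
          best := some (better I s.best S)
          halted := False }

/-- `Run I ε k s`: some run of the algorithm is in state `s` after processing exactly `k` nodes. -/
inductive Run (I : UniformInstance n m) (ε : ℝ) : ℕ → State n m → Prop
  | start : Run I ε 0 (initial n m)
  | step {k : ℕ} {s s' : State n m} : Run I ε k s → Step I ε s s' → Run I ε (k + 1) s'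

end

end SimProf

namespace SimProf

/-! ### The relaxation of a node and completions of a node by a schedule -/

namespace UniformInstance

variable {n m : ℕ} (I : UniformInstance n m)

/-! Fix an optimal schedule `S`. A node of depth `d` follows `S` if completing it by `S` costs at
most `d * ε / n` root bounds extra on every machine; its `LB` is then at most `(1 + ε)` times the
optimum. The root follows `S`. If a processed node follows `S`, so does its child along `S`. If that
child was discarded for similarity, the similar node kept instead lies one level deeper and still
follows `S`, as one similarity costs at most `ε / n`. So the deepest tree node following `S` is
either active, or its child was discarded because the incumbent was already good; the cube never
excludes it, because the optimum is at most twice the root bound (`Invariant.best_or_active`). The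
stopping rule costs the second factor `1 + ε`.

The factor 2, and the possibility of rounding at all, come from vertices: an extreme point has so
few nonzero coordinates that its fractional jobs satisfy Hall's condition (`card_le_card_support`),
so each machine receives at most one of them.

For the node count, kept nodes of equal depth have pairwise dissimilar profiles in a cube and hence
occupy different grid cells (`card_le_of_pairwise_not_similar`). -/

theorem mem_partialLP_iff {U : Finset (Fin n)} {t : Fin m → ℕ} {T : ℕ}
    {x : Fin n → Fin m → ℝ} :
    x ∈ I.partialLP U t T ↔
      (∀ j ∈ U, ∑ i, x j i = 1) ∧
      (∀ i, ∑ j, (I.time j i : ℝ) * x j i ≤ (T : ℝ) - (t i : ℝ)) ∧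
      (∀ j i, 0 ≤ x j i) ∧
      (∀ j i, ¬ (j ∈ U ∧ I.time j i ≤ T) → x j i = 0) := by
  -- Coordinates without a variable vanish, so the filtered sums may be taken over everything.
  have row : (∀ j i, ¬ (j ∈ U ∧ I.time j i ≤ T) → x j i = 0) →
      ∀ j, ∑ i with I.time j i ≤ T, x j i = ∑ i, x j i := by
    intro h j
    rw [Finset.sum_filter]
    refine Finset.sum_congr rfl fun i _ => ?_
    split_ifs with hT
    · rfl
    · exact (h j i fun h' => hT h'.2).symm
  have col : (∀ j i, ¬ (j ∈ U ∧ I.time j i ≤ T) → x j i = 0) →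
      ∀ i, ∑ j ∈ U with I.time j i ≤ T, (I.time j i : ℝ) * x j i
        = ∑ j, (I.time j i : ℝ) * x j i := by
    intro h i
    refine Finset.sum_subset (Finset.subset_univ _) fun j _ hj => ?_
    rw [h j i fun h' => hj (Finset.mem_filter.2 h'), mul_zero]
  constructor
  · rintro ⟨h1, h2, h3, h4⟩
    refine ⟨fun j hj => row h4 j ▸ h1 j hj, fun i => col h4 i ▸ h2 i, fun j i => ?_, h4⟩
    by_cases h : j ∈ U ∧ I.time j i ≤ T
    · exact h3 j i h.1 h.2
    · exact (h4 j i h).ge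
  · rintro ⟨h1, h2, h3, h4⟩
    exact ⟨fun j hj => (row h4 j).trans (h1 j hj), fun i => (col h4 i).trans_le (h2 i),
      fun j i _ _ => h3 j i, h4⟩

theorem isCompact_partialLP (U : Finset (Fin n)) (t : Fin m → ℕ) (T : ℕ) :
    IsCompact (I.partialLP U t T) := by
  have hset : I.partialLP U t T = {x | (∀ j ∈ U, ∑ i, x j i = 1) ∧
      (∀ i, ∑ j, (I.time j i : ℝ) * x j i ≤ (T : ℝ) - (t i : ℝ)) ∧
      (∀ j i, 0 ≤ x j i) ∧
      (∀ j i, ¬ (j ∈ U ∧ I.time j i ≤ T) → x j i = 0)} :=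
    Set.ext fun x => I.mem_partialLP_iff
  have hclosed : IsClosed (I.partialLP U t T) := by
    rw [hset]
    simp only [Set.ofPred_and, Set.ofPred_forall]
    refine IsClosed.inter ?_ (IsClosed.inter ?_ (IsClosed.inter ?_ ?_))
    · exact isClosed_iInter fun j => isClosed_iInter fun _ =>
        isClosed_eq (by fun_prop) continuous_const
    · exact isClosed_iInter fun i => isClosed_le (by fun_prop) continuous_const
    · exact isClosed_iInter fun j => isClosed_iInter fun i =>
        isClosed_le continuous_const (by fun_prop)
    · exact isClosed_iInter fun j => isClosed_iInter fun i => isClosed_iInter fun _ =>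
        isClosed_eq (by fun_prop) continuous_const
  refine (isCompact_Icc (a := (0 : Fin n → Fin m → ℝ)) (b := 1)).of_isClosed_subset hclosed ?_
  intro x hx
  obtain ⟨h1, -, h3, h4⟩ := I.mem_partialLP_iff.1 hx
  refine ⟨fun j i => h3 j i, fun j i => ?_⟩
  by_cases hj : j ∈ U
  · calc x j i ≤ ∑ i, x j i :=
          Finset.single_le_sum (f := x j) (fun i _ => h3 j i) (Finset.mem_univ i)
      _ = 1 := h1 j hj
  · rw [h4 j i fun h => hj h.1]
    exact zero_le_one

theorem mem_unfixed {v : Node m} {j : Fin n} : j ∈ I.unfixed v ↔ v.length ≤ (j : ℕ) := by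
  simp [unfixed]

/-- The schedule that agrees with the node `v` on the jobs fixed there and with `S` on the
remaining jobs. -/
def extend (v : Node m) (S : Schedule n m) : Schedule n m :=
  fun j => (v[(j : ℕ)]?).getD (S j)

theorem completion_extend (v : Node m) (S : Schedule n m) (i : Fin m) :
    I.completion (extend v S) i =
      I.overhead v i + ∑ j ∈ I.unfixed v with S j = i, I.time j i := by
  rw [completion, overhead, unfixed, Finset.filter_filter, Finset.sum_filter, Finset.sum_filter,
    ← Finset.sum_add_distrib]
  refine Finset.sum_congr rfl fun j _ => ?_
  by_cases hj : v.length ≤ (j : ℕ)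
  · simp [extend, hj]
  · have : (j : ℕ) < v.length := not_le.1 hj
    simp [extend, List.getElem?_eq_getElem this, hj]

theorem overhead_le_completion_extend (v : Node m) (S : Schedule n m) (i : Fin m) :
    I.overhead v i ≤ I.completion (extend v S) i :=
  I.completion_extend v S i ▸ Nat.le_add_right _ _

theorem completion_le_makespan (S : Schedule n m) (i : Fin m) :
    I.completion S i ≤ I.makespan S :=
  Finset.le_sup (f := I.completion S) (Finset.mem_univ i)

theorem time_le_makespan (S : Schedule n m) (j : Fin n) : I.time j (S j) ≤ I.makespan S := by
  refine le_trans ?_ (I.completion_le_makespan S (S j))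
  exact Finset.single_le_sum (f := fun k => I.time k (S j)) (fun _ _ => Nat.zero_le _)
    (Finset.mem_filter.2 ⟨Finset.mem_univ j, rfl⟩)

/-- The indicator of a schedule extending `v` is feasible for its makespan. -/
theorem partialLP_makespan_nonempty (v : Node m) (S : Schedule n m) :
    (I.partialLP (I.unfixed v) (I.overhead v) (I.makespan (extend v S))).Nonempty := by
  classical
  have hS : ∀ j ∈ I.unfixed v, extend v S j = S j := fun j hj => by
    simp [extend, List.getElem?_eq_none (I.mem_unfixed.1 hj)]
  refine ⟨fun j i => if j ∈ I.unfixed v ∧ S j = i then 1 else 0, I.mem_partialLP_iff.2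
    ⟨fun j hj => ?_, fun i => ?_, fun j i => ?_, fun j i h => ?_⟩⟩
  · simp [hj]
  · have hc := I.completion_le_makespan (extend v S) i
    rw [completion_extend] at hc
    have hc' : (I.overhead v i : ℝ) + ∑ j ∈ I.unfixed v with S j = i, (I.time j i : ℝ)
        ≤ I.makespan (extend v S) := by exact_mod_cast hc
    have : ∑ j, (I.time j i : ℝ) * (if j ∈ I.unfixed v ∧ S j = i then 1 else 0)
        = ∑ j ∈ I.unfixed v with S j = i, (I.time j i : ℝ) := by
      rw [unfixed, Finset.filter_filter, Finset.sum_filter]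
      refine Finset.sum_congr rfl fun j _ => ?_
      simp
    linarith
  · positivity
  · refine if_neg fun h' => h ⟨h'.1, ?_⟩
    have := I.time_le_makespan (extend v S) j
    rwa [hS j h'.1, h'.2] at this

theorem LB_le_makespan_extend (v : Node m) (S : Schedule n m) :
    I.LB v ≤ I.makespan (extend v S) :=
  Nat.sInf_le (I.partialLP_makespan_nonempty v S)

theorem extend_nil (S : Schedule n m) : extend [] S = S := by
  funext j
  simp [extend]

theorem LB_nil_le_makespan (S : Schedule n m) : I.LB [] ≤ I.makespan S := by
  simpa only [extend_nil] using I.LB_le_makespan_extend [] S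

/-- Any schedule shows that some `T` is feasible, so the infimum `LB` is attained; a nonempty
compact set has an extreme point. -/
theorem vertices_nonempty (hm : 0 < m) (v : Node m) : (I.vertices v).Nonempty := by
  refine (I.isCompact_partialLP _ _ _).extremePoints_nonempty ?_
  exact Nat.sInf_mem (s := {T : ℕ | (I.partialLP (I.unfixed v) (I.overhead v) T).Nonempty})
    ⟨_, I.partialLP_makespan_nonempty v fun _ => ⟨0, hm⟩⟩

/-! ### Extreme points and their rounding -/

/-- An extreme point of the relaxation admits no nonzero direction along which its support, the
job equations and the machine loads are all preserved. -/
theorem eq_zero_of_mem_extremePoints {U : Finset (Fin n)} {t : Fin m → ℕ} {T : ℕ}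
    {x D : Fin n → Fin m → ℝ} (hx : x ∈ (I.partialLP U t T).extremePoints ℝ)
    (hsupp : ∀ j i, x j i = 0 → D j i = 0) (hrow : ∀ j, ∑ i, D j i = 0)
    (hcol : ∀ i, ∑ j, (I.time j i : ℝ) * D j i = 0) : D = 0 := by
  rw [mem_extremePoints] at hx
  obtain ⟨hmem, hext⟩ := hx
  obtain ⟨h1, h2, h3, h4⟩ := I.mem_partialLP_iff.1 hmem
  -- Zero coordinates do not move along `D` and positive ones have slack, so a small step both ways
  -- stays nonnegative and `x` is the midpoint of two feasible points.
  obtain ⟨δ, hδ, hle⟩ : ∃ δ : ℝ, 0 < δ ∧ ∀ j i, δ * |D j i| ≤ x j i := by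
    have hev : ∀ᶠ δ : ℝ in nhdsWithin 0 (Set.Ioi 0), ∀ j i, δ * |D j i| ≤ x j i := by
      refine Filter.eventually_all.2 fun j => Filter.eventually_all.2 fun i => ?_
      by_cases h0 : x j i = 0
      · exact Filter.Eventually.of_forall fun δ => by simp [h0, hsupp j i h0]
      · have hpos : 0 < x j i := lt_of_le_of_ne (h3 j i) (Ne.symm h0)
        have hlim : Filter.Tendsto (fun δ : ℝ => δ * |D j i|) (nhdsWithin 0 (Set.Ioi 0))
            (nhds 0) := by
          have : Filter.Tendsto (fun δ : ℝ => δ * |D j i|) (nhds 0) (nhds (0 * |D j i|)) :=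
            (continuous_id.mul continuous_const).tendsto 0
          rw [zero_mul] at this
          exact this.mono_left nhdsWithin_le_nhds
        exact hlim.eventually (ge_mem_nhds hpos)
    obtain ⟨δ, h, hδ⟩ := (hev.and self_mem_nhdsWithin).exists
    exact ⟨δ, hδ, h⟩
  have feasible : ∀ c : ℝ, |c| = δ → x + c • D ∈ I.partialLP U t T := by
    intro c hc
    refine I.mem_partialLP_iff.2 ⟨fun j hj => ?_, fun i => ?_, fun j i => ?_, fun j i h => ?_⟩
    · simp [Finset.sum_add_distrib, ← Finset.mul_sum, hrow, h1 j hj]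
    · have : ∑ j, (I.time j i : ℝ) * (x + c • D) j i
          = ∑ j, (I.time j i : ℝ) * x j i + c * ∑ j, (I.time j i : ℝ) * D j i := by
        rw [Finset.mul_sum, ← Finset.sum_add_distrib]
        refine Finset.sum_congr rfl fun j _ => ?_
        simp only [Pi.add_apply, Pi.smul_apply, smul_eq_mul]
        ring
      rw [this, hcol, mul_zero, add_zero]
      exact h2 i
    · have hb := hle j i
      rw [← hc, ← abs_mul] at hb
      have := neg_abs_le (c * D j i)
      simp only [Pi.add_apply, Pi.smul_apply, smul_eq_mul]
      linarith
    · simp [h4 j i h, hsupp j i (h4 j i h)]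
  have heq := hext _ (feasible δ (abs_of_pos hδ)) _ (feasible (-δ) (by simp [abs_of_pos hδ]))
    ⟨1 / 2, 1 / 2, by norm_num, by norm_num, by norm_num, by
      ext j i
      simp only [Pi.add_apply, Pi.smul_apply, smul_eq_mul]
      ring⟩
  have : δ • D = 0 := by simpa using heq.1
  exact (smul_eq_zero.1 this).resolve_left hδ.ne'

open Classical in
/-- Hall's condition for the fractional jobs of an extreme point. -/
theorem card_le_card_support {U : Finset (Fin n)} {t : Fin m → ℕ} {T : ℕ}
    {x : Fin n → Fin m → ℝ} (hx : x ∈ (I.partialLP U t T).extremePoints ℝ)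
    (J : Finset (Fin n)) (hJ : ∀ j ∈ J, IsFractional x j) :
    J.card ≤ (J.biUnion fun j => {i | x j i ≠ 0}).card := by
  obtain ⟨h1, h2, h3, h4⟩ := I.mem_partialLP_iff.1 (extremePoints_subset hx)
  set M : Finset (Fin m) := J.biUnion fun j => {i | x j i ≠ 0} with hM
  -- A job supported on a single machine would have value 1 there by its job equation.
  have htwo : ∀ j ∈ J, 2 ≤ (Finset.univ.filter fun i => x j i ≠ 0).card := by
    intro j hj
    obtain ⟨i, hi0, hi1⟩ := hJ j hj
    have hjU : j ∈ U := by
      by_contra h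
      exact hi0 (h4 j i fun h' => h h'.1)
    by_contra hlt
    have hmem : i ∈ Finset.univ.filter fun i => x j i ≠ 0 := by simpa using hi0
    have hone : (Finset.univ.filter fun i => x j i ≠ 0).card ≤ 1 := by omega
    refine hi1 ?_
    rw [← h1 j hjU]
    refine (Finset.sum_eq_single i (fun k _ hk => ?_) (by simp)).symm
    by_contra hk0
    exact hk (Finset.card_le_one.1 hone k (by simpa using hk0) i hmem)
  let E : Finset (Σ _ : Fin n, Fin m) := J.sigma fun j => {i | x j i ≠ 0}
  have hE : 2 * J.card ≤ E.card := by
    rw [Finset.card_sigma, mul_comm, ← smul_eq_mul]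
    exact Finset.card_nsmul_le_sum J _ 2 htwo
  by_contra hlt
  let D : Fin n → Fin m → ((E → ℝ) →ₗ[ℝ] ℝ) := fun j i =>
    if h : (⟨j, i⟩ : Σ _ : Fin n, Fin m) ∈ E then LinearMap.proj ⟨⟨j, i⟩, h⟩ else 0
  let L : (E → ℝ) →ₗ[ℝ] ((J ⊕ M) → ℝ) := LinearMap.pi
    (Sum.elim (fun j => ∑ i, D j i) (fun i => ∑ j, (I.time j i : ℝ) • D j i))
  -- If Hall's condition fails, there are at least `2 * J.card` support variables but only `J.card +
  -- M.card < 2 * J.card` equations, which leaves a forbidden nonzero direction.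
  have hker : LinearMap.ker L ≠ ⊥ := by
    refine LinearMap.ker_ne_bot_of_finrank_lt ?_
    rw [Module.finrank_fintype_fun_eq_card, Module.finrank_fintype_fun_eq_card,
      Fintype.card_sum, Fintype.card_coe, Fintype.card_coe, Fintype.card_coe]
    omega
  obtain ⟨d, hd, hd0⟩ := (Submodule.ne_bot_iff _).1 hker
  have hL : ∀ r, L d r = 0 := fun r => congrFun (LinearMap.mem_ker.1 hd) r
  have hDout : ∀ j i, (⟨j, i⟩ : Σ _ : Fin n, Fin m) ∉ E → D j i d = 0 := fun j i h => by
    simp [D, h]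
  have memE : ∀ j i, (⟨j, i⟩ : Σ _ : Fin n, Fin m) ∈ E ↔ j ∈ J ∧ x j i ≠ 0 := by
    intro j i
    simp [E]
  have hzero : (fun j i => D j i d) = 0 := by
    refine I.eq_zero_of_mem_extremePoints hx (fun j i h => ?_) (fun j => ?_) (fun i => ?_)
    · exact hDout j i fun h' => ((memE j i).1 h').2 h
    · by_cases hj : j ∈ J
      · simpa [L] using hL (Sum.inl ⟨j, hj⟩)
      · exact Finset.sum_eq_zero fun i _ => hDout j i fun h' => hj ((memE j i).1 h').1
    · by_cases hi : i ∈ M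
      · simpa [L] using hL (Sum.inr ⟨i, hi⟩)
      · refine Finset.sum_eq_zero fun j _ => ?_
        rw [hDout j i, mul_zero]
        intro h'
        obtain ⟨hj, hxj⟩ := (memE j i).1 h'
        exact hi (Finset.mem_biUnion.2 ⟨j, hj, by simpa using hxj⟩)
  refine hd0 (funext fun e => ?_)
  obtain ⟨⟨j, i⟩, he⟩ := e
  have := congrFun (congrFun hzero j) i
  simpa [D, he] using this

/-- Hall's theorem matches the fractional jobs; an unfixed integral job has a coordinate 1 because
its row sums to 1. -/
theorem exists_isRounding (hm : 0 < m) {v : Node m} {x : Fin n → Fin m → ℝ}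
    (hx : x ∈ I.vertices v) : ∃ S : Schedule n m, IsRounding v x S := by
  classical
  obtain ⟨h1, -, -, h4⟩ := I.mem_partialLP_iff.1 (extremePoints_subset hx)
  obtain ⟨f, hf, hfx⟩ := (Finset.all_card_le_biUnion_card_iff_exists_injective
    (fun j : {j // IsFractional x j} => (Finset.univ.filter fun i => x j i ≠ 0))).1 (by
      intro s
      have := I.card_le_card_support hx (s.map (Function.Embedding.subtype _))
        (fun j hj => by
          obtain ⟨a, _, rfl⟩ := Finset.mem_map.1 hj
          exact a.2)
      rw [Finset.card_map] at this
      refine this.trans (Finset.card_le_card fun i hi => ?_)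
      obtain ⟨j, hj, hji⟩ := Finset.mem_biUnion.1 hi
      obtain ⟨a, ha, rfl⟩ := Finset.mem_map.1 hj
      exact Finset.mem_biUnion.2 ⟨a, ha,
        Finset.mem_filter.2 ⟨Finset.mem_univ i, (Finset.mem_filter.1 hji).2⟩⟩)
  have hfix : ∀ j : Fin n, IsFractional x j → v.length ≤ (j : ℕ) := by
    rintro j ⟨i, hi, -⟩
    by_contra h
    exact hi (h4 j i fun h' => h (I.mem_unfixed.1 h'.1))
  have hint : ∀ j : Fin n, ∃ i, v.length ≤ (j : ℕ) → ¬ IsFractional x j → x j i = 1 := by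
    intro j
    by_contra! hcon
    have hj := (hcon ⟨0, hm⟩).1
    have hzero : ∀ i, x j i = 0 := fun i => by
      by_contra hi
      exact (hcon i).2.1 ⟨i, hi, (hcon i).2.2⟩
    have := h1 j (I.mem_unfixed.2 hj)
    simp [hzero] at this
  choose g hg using hint
  refine ⟨fun j => if h : IsFractional x j then f ⟨j, h⟩ else extend v g j,
    fun j hj => ?_, fun j hj hfr => ?_, fun j hfr => ?_, fun j hj k hk hjk => ?_⟩
  · have : ¬ IsFractional x j := fun h => absurd (hfix j h) (not_le.2 hj)
    simp [this, extend, List.getElem?_eq_getElem hj]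
  · simpa [hfr, extend, List.getElem?_eq_none hj] using hg j hj hfr
  · simpa [hfr] using hfx ⟨j, hfr⟩
  · have hj' : IsFractional x j := hj
    have hk' : IsFractional x k := hk
    simp only [hj', hk', dif_pos] at hjk
    exact congrArg Subtype.val (hf hjk)

theorem IsRounding.extend_eq {v : Node m} {x : Fin n → Fin m → ℝ} {S : Schedule n m}
    (h : IsRounding v x S) : extend v S = S := by
  funext j
  by_cases hj : (j : ℕ) < v.length
  · simp [extend, h.1 j hj]
  · simp [extend, List.getElem?_eq_none (not_lt.1 hj)]

/-- On every machine, the integral jobs of a rounded vertex respect the lower bound. -/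
theorem overhead_add_integral_le {v : Node m} {x : Fin n → Fin m → ℝ} (hx : x ∈ I.vertices v)
    {S : Schedule n m} (hS : IsRounding v x S) (i : Fin m) (A : Finset (Fin n))
    (hA : ∀ j ∈ A, v.length ≤ (j : ℕ) ∧ S j = i ∧ ¬ IsFractional x j) :
    I.overhead v i + ∑ j ∈ A, I.time j i ≤ I.LB v := by
  obtain ⟨-, h2, h3, -⟩ := I.mem_partialLP_iff.1 (extremePoints_subset hx)
  have hA' : ∑ j ∈ A, (I.time j i : ℝ) ≤ ∑ j, (I.time j i : ℝ) * x j i := by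
    calc ∑ j ∈ A, (I.time j i : ℝ) = ∑ j ∈ A, (I.time j i : ℝ) * x j i := by
          refine Finset.sum_congr rfl fun j hj => ?_
          obtain ⟨hj1, hj2, hj3⟩ := hA j hj
          rw [← hj2, hS.2.1 j hj1 hj3, mul_one]
      _ ≤ _ := Finset.sum_le_sum_of_subset_of_nonneg (Finset.subset_univ A)
          fun j _ _ => mul_nonneg (Nat.cast_nonneg _) (h3 j i)
  have : (I.overhead v i : ℝ) + ∑ j ∈ A, (I.time j i : ℝ) ≤ I.LB v := by
    linarith [h2 i]
  exact_mod_cast this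

theorem makespan_le_LB_of_integral {v : Node m} {x : Fin n → Fin m → ℝ} (hx : x ∈ I.vertices v)
    (hint : ∀ j, ¬ IsFractional x j) {S : Schedule n m} (hS : IsRounding v x S) :
    I.makespan S ≤ I.LB v := by
  refine Finset.sup_le fun i _ => ?_
  rw [← IsRounding.extend_eq hS, completion_extend]
  refine I.overhead_add_integral_le hx hS i _ fun j hj => ?_
  rw [Finset.mem_filter, mem_unfixed] at hj
  exact ⟨hj.1, hj.2, hint j⟩

/-- Fixed and integral jobs fit within `LB v`. Injectivity adds at most one fractional job per
machine, of time at most `LB v` since the pair lies in the support. -/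
theorem makespan_le_two_mul_LB {v : Node m} {x : Fin n → Fin m → ℝ} (hx : x ∈ I.vertices v)
    {S : Schedule n m} (hS : IsRounding v x S) : I.makespan S ≤ 2 * I.LB v := by
  classical
  obtain ⟨-, -, -, h4⟩ := I.mem_partialLP_iff.1 (extremePoints_subset hx)
  refine Finset.sup_le fun i _ => ?_
  rw [← IsRounding.extend_eq hS, completion_extend,
    ← Finset.sum_filter_add_sum_filter_not _ (fun j => IsFractional x j)]
  have hintegral := I.overhead_add_integral_le hx hS i
    (((I.unfixed v).filter fun j => S j = i).filter fun j => ¬ IsFractional x j)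
    fun j hj => by
      rw [Finset.mem_filter, Finset.mem_filter, mem_unfixed] at hj
      exact ⟨hj.1.1, hj.1.2, hj.2⟩
  have hfrac : ∑ j ∈ ((I.unfixed v).filter fun j => S j = i).filter fun j => IsFractional x j,
      I.time j i ≤ I.LB v := by
    refine (Finset.sum_le_card_nsmul _ _ (I.LB v) fun j hj => ?_).trans ?_
    · rw [Finset.mem_filter, Finset.mem_filter] at hj
      by_contra hT
      refine hS.2.2.1 j hj.2 ?_
      rw [hj.1.2]
      exact h4 j i fun h => hT h.2
    · rw [smul_eq_mul]
      refine (Nat.mul_le_mul_right _ (Finset.card_le_one.2 fun j hj k hk => ?_)).trans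
        (one_mul _).le
      rw [Finset.mem_filter, Finset.mem_filter] at hj hk
      exact hS.2.2.2 hj.2 hk.2 (hj.1.2.trans hk.1.2.symm)
  omega

/-- Rounding a vertex at the root gives the factor 2, which later keeps the nodes along the optimum
inside the cube. -/
theorem exists_optimal_schedule (hm : 0 < m) : ∃ S : Schedule n m,
    (∀ S', I.makespan S ≤ I.makespan S') ∧ I.makespan S ≤ 2 * I.LB [] := by
  have : Nonempty (Fin m) := ⟨⟨0, hm⟩⟩
  obtain ⟨S, hS⟩ := Finite.exists_min (fun S : Schedule n m => I.makespan S)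
  obtain ⟨x, hx⟩ := I.vertices_nonempty hm []
  obtain ⟨R, hR⟩ := I.exists_isRounding hm hx
  exact ⟨S, hS, (hS R).trans (I.makespan_le_two_mul_LB hx hR)⟩

theorem makespan_reorder (σ : Equiv.Perm (Fin n)) (S : Schedule n m) :
    (I.reorder σ).makespan S = I.makespan (S ∘ σ.symm) := by
  unfold makespan
  congr 1
  funext i
  unfold completion
  rw [Finset.sum_filter, Finset.sum_filter,
    ← Equiv.sum_comp σ fun j => if (S ∘ σ.symm) j = i then I.time j i else 0]
  simp [time, reorder]

end UniformInstance

end SimProf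

namespace SimProf

variable {n m : ℕ}

namespace UniformInstance

variable (I : UniformInstance n m)

/-! ### Profiles and the grid -/

theorem similar_refl {ε : ℝ} (hε : 0 < ε) (v : Node m) : I.Similar ε v v := fun i => by
  rw [sub_self, abs_zero]
  positivity

/-- This survives division by zero: if the root bound is 0, the optimum is 0, so all lengths and
overheads vanish. -/
theorem overhead_eq_profile_mul (hm : 0 < m) (v : Node m) (i : Fin m) :
    (I.overhead v i : ℝ) = I.profile v i * I.LB [] := by
  unfold profile
  by_cases h : I.LB [] = 0
  · have hzero : I.overhead v i = 0 := by
      obtain ⟨S, -, hS⟩ := I.exists_optimal_schedule hm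
      have hp : ∀ j, I.p j = 0 := fun j => by
        have h1 := I.time_le_makespan S j
        have h2 : I.p j / I.s (S j) = 0 := Nat.le_zero.1 (h1.trans (hS.trans (by rw [h])))
        have h3 := Nat.div_mul_cancel (I.dvd j (S j))
        rw [h2, zero_mul] at h3
        exact h3.symm
      exact Finset.sum_eq_zero fun j _ => by simp [time, hp]
    simp [h, hzero]
  · have : (I.LB [] : ℝ) ≠ 0 := Nat.cast_ne_zero.2 h
    field_simp

theorem profile_nonneg (v : Node m) (i : Fin m) : 0 ≤ I.profile v i := by
  unfold profile
  positivity

theorem profile_nil (i : Fin m) : I.profile [] i = 0 := by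
  simp [profile, overhead]

/-- Pairwise dissimilar profiles in the cube of side `2 (1 + ε) ^ 2` lie in different cells of the
grid of width `ε / n`. -/
theorem card_le_of_pairwise_not_similar (hn : 0 < n) {ε : ℝ} (hε : 0 < ε)
    (A : Finset (Node m)) (hcube : ∀ v ∈ A, ∀ i, I.profile v i ≤ 2 * (1 + ε) ^ 2)
    (hA : ∀ u ∈ A, ∀ v ∈ A, I.Similar ε u v → u = v) :
    (A.card : ℝ) ≤ (3 * (n : ℝ) * (1 + ε) ^ 2 / ε) ^ m := by
  have hn' : (0 : ℝ) < n := Nat.cast_pos.2 hn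
  set δ : ℝ := ε / n with hδ
  have hδ0 : 0 < δ := div_pos hε hn'
  set K : ℕ := ⌊2 * (1 + ε) ^ 2 / δ⌋₊ with hK
  let cell : Node m → (Fin m → ℕ) := fun v i => ⌊I.profile v i / δ⌋₊
  have hmaps : ∀ v ∈ A, cell v ∈ Fintype.piFinset fun _ : Fin m => Finset.range (K + 1) := by
    intro v hv
    rw [Fintype.mem_piFinset]
    intro i
    rw [Finset.mem_range, Nat.lt_succ_iff]
    exact Nat.floor_le_floor (div_le_div_of_nonneg_right (hcube v hv i) hδ0.le)
  have hinj : Set.InjOn cell A := by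
    intro u hu v hv huv
    refine hA u hu v hv fun i => ?_
    have hi : ⌊I.profile u i / δ⌋₊ = ⌊I.profile v i / δ⌋₊ := congrFun huv i
    have hu0 := div_nonneg (I.profile_nonneg u i) hδ0.le
    have hv0 := div_nonneg (I.profile_nonneg v i) hδ0.le
    have h1 := Nat.floor_le hu0
    have h2 := Nat.lt_floor_add_one (I.profile u i / δ)
    have h3 := Nat.floor_le hv0
    have h4 := Nat.lt_floor_add_one (I.profile v i / δ)
    rw [hi] at h1 h2
    have h5 : |I.profile u i / δ - I.profile v i / δ| ≤ 1 := by
      rw [abs_le]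
      constructor <;> linarith
    rwa [← sub_div, abs_div, abs_of_pos hδ0, div_le_one hδ0] at h5
  have hcard := Finset.card_le_card_of_injOn cell hmaps hinj
  rw [Fintype.card_piFinset, Finset.prod_const, Finset.card_range, Finset.card_univ,
    Fintype.card_fin] at hcard
  -- The constant 3 is the cube's 2 plus 1: the extra cell from the floor is absorbed by `(1 + ε) ^
  -- 2 / δ ≥ 1`.
  have hbase : ((K + 1 : ℕ) : ℝ) ≤ 3 * (n : ℝ) * (1 + ε) ^ 2 / ε := by
    have h1 : (K : ℝ) ≤ 2 * (1 + ε) ^ 2 / δ := Nat.floor_le (by positivity)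
    have h2 : (1 : ℝ) ≤ (1 + ε) ^ 2 / δ := by
      rw [le_div_iff₀ hδ0, one_mul, hδ]
      have : ε / n ≤ ε := div_le_self hε.le (by exact_mod_cast hn)
      nlinarith
    have h3 : 3 * (n : ℝ) * (1 + ε) ^ 2 / ε = 2 * (1 + ε) ^ 2 / δ + (1 + ε) ^ 2 / δ := by
      rw [hδ]
      field_simp
      ring
    rw [h3]
    push_cast
    linarith
  calc (A.card : ℝ) ≤ (((K + 1) ^ m : ℕ) : ℝ) := by exact_mod_cast hcard
    _ = ((K + 1 : ℕ) : ℝ) ^ m := by push_cast; rfl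
    _ ≤ _ := pow_le_pow_left₀ (by positivity) hbase m

end UniformInstance

/-! ### Invariants of a run -/

variable {I : UniformInstance n m} {ε : ℝ}

theorem makespan_better_le (b : Option (Schedule n m)) (S : Schedule n m) :
    I.makespan (better I b S) ≤ I.makespan S := by
  unfold better
  split
  · rfl
  · split_ifs with h
    · rfl
    · exact not_lt.1 h

theorem makespan_better_some_le (B S : Schedule n m) :
    I.makespan (better I (some B) S) ≤ I.makespan B := by
  unfold better
  simp only
  split_ifs with h
  · exact h.le
  · rfl

/-- Incumbents only improve and the tree only grows, so a reason for discarding stays valid in all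
later states. -/
theorem Discarded.mono {B B' : Schedule n m} {tree tree' : Finset (Node m)} {u : Node m}
    (h : Discarded I ε B tree u) (hB : I.makespan B' ≤ I.makespan B) (ht : tree ⊆ tree') :
    Discarded I ε B' tree' u := by
  rcases h with h | h | ⟨w, hw, h⟩
  · exact Or.inl (hB.trans_lt h)
  · exact Or.inr (Or.inl h)
  · exact Or.inr (Or.inr ⟨w, ht hw, h⟩)

/-- The part of the invariant that is maintained while the children of a node are examined:
the tree contains the active nodes, its nodes fix at most `n` jobs, and at every depth their
profiles are pairwise dissimilar and lie in the cube. -/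
structure TreeInvariant (I : UniformInstance n m) (ε : ℝ) (active tree : Finset (Node m)) :
    Prop where
  active_subset : active ⊆ tree
  length_le : ∀ v ∈ tree, v.length ≤ n
  eq_of_similar : ∀ u ∈ tree, ∀ v ∈ tree, u.length = v.length → I.Similar ε u v → u = v
  profile_le : ∀ v ∈ tree, ∀ i, I.profile v i ≤ 2 * (1 + ε) ^ 2

theorem UniformInstance.Similar.symm {u v : Node m} (h : I.Similar ε u v) : I.Similar ε v u :=
  fun i => abs_sub_comm (I.profile v i) _ ▸ h i

theorem not_mem_of_not_discarded (hε : 0 < ε) {B : Schedule n m} {tree : Finset (Node m)}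
    {u : Node m} (h : ¬ Discarded I ε B tree u) : u ∉ tree :=
  fun hu => h (Or.inr (Or.inr ⟨u, hu, rfl, I.similar_refl hε u⟩))

theorem TreeInvariant.insert {active tree : Finset (Node m)} (h : TreeInvariant I ε active tree)
    {B : Schedule n m} {u : Node m} (hu : u.length ≤ n) (hd : ¬ Discarded I ε B tree u) :
    TreeInvariant I ε (insert u active) (insert u tree) where
  active_subset := Finset.insert_subset_insert u h.active_subset
  length_le := by
    intro v hv
    rcases Finset.mem_insert.1 hv with rfl | hv
    · exact hu
    · exact h.length_le v hv
  eq_of_similar := by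
    intro v hv w hw hlen hs
    rcases Finset.mem_insert.1 hv with hvu | hvt <;>
      rcases Finset.mem_insert.1 hw with hwu | hwt
    · exact hvu.trans hwu.symm
    · subst hvu
      exact absurd (Or.inr (Or.inr ⟨w, hwt, hlen.symm, hs.symm⟩)) hd
    · subst hwu
      exact absurd (Or.inr (Or.inr ⟨v, hvt, hlen, hs⟩)) hd
    · exact h.eq_of_similar v hvt w hwt hlen hs
  profile_le := by
    intro v hv i
    rcases Finset.mem_insert.1 hv with rfl | hv
    · by_contra hlt
      exact hd (Or.inr (Or.inl ⟨i, not_le.1 hlt⟩))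
    · exact h.profile_le v hv i

open Classical in
/-- Effect of examining the children of `v` on the machines of the list `l`. -/
theorem foldl_children (hε : 0 < ε) (B : Schedule n m) {v : Node m} (hv : v.length < n)
    (l : List (Fin m)) (q : Finset (Node m) × Finset (Node m)) (hq : TreeInvariant I ε q.1 q.2) :
    let r := l.foldl (fun q i => if Discarded I ε B q.2 (v ++ [i]) then q
      else (insert (v ++ [i]) q.1, insert (v ++ [i]) q.2)) q
    TreeInvariant I ε r.1 r.2 ∧ q.2 ⊆ r.2 ∧ r.2 \ r.1 = q.2 \ q.1 ∧
      ∀ i ∈ l, Discarded I ε B r.2 (v ++ [i]) := by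
  induction l generalizing q with
  | nil => exact ⟨hq, subset_rfl, rfl, by simp⟩
  | cons i l ih =>
    simp only [List.foldl_cons]
    split_ifs with hd
    · obtain ⟨h1, h2, h3, h4⟩ := ih q hq
      refine ⟨h1, h2, h3, fun k hk => ?_⟩
      rcases List.mem_cons.1 hk with rfl | hk
      · exact hd.mono le_rfl h2
      · exact h4 k hk
    · have hmem := not_mem_of_not_discarded hε hd
      obtain ⟨h1, h2, h3, h4⟩ := ih (insert (v ++ [i]) q.1, insert (v ++ [i]) q.2)
        (hq.insert (by simpa using hv) hd)
      refine ⟨h1, (Finset.subset_insert _ _).trans h2, ?_, fun k hk => ?_⟩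
      · rw [h3]
        ext w
        simp only [Finset.mem_sdiff, Finset.mem_insert]
        constructor
        · rintro ⟨rfl | h, h'⟩
          · exact absurd (Or.inl rfl) h'
          · exact ⟨h, fun hw => h' (Or.inr hw)⟩
        · rintro ⟨h, h'⟩
          refine ⟨Or.inr h, ?_⟩
          rintro (rfl | hw)
          · exact hmem h
          · exact h' hw
      · rcases List.mem_cons.1 hk with rfl | hk
        -- A child that was kept is similar to itself in the final tree, so `Discarded` holds for
        -- all children uniformly.
        · exact Or.inr (Or.inr ⟨_, h2 (Finset.mem_insert_self _ _), rfl, I.similar_refl hε _⟩)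
        · exact h4 k hk

/-- The invariant of the states in which no integral vertex has been found; `k` is the number of
processed nodes. -/
structure Invariant (I : UniformInstance n m) (ε : ℝ) (k : ℕ) (s : State n m) : Prop
    extends TreeInvariant I ε s.active s.tree where
  root_mem : [] ∈ s.tree
  card_processed : (s.tree \ s.active).card = k
  length_lt : ∀ v ∈ s.tree \ s.active, v.length < n
  discarded : ∀ v ∈ s.tree \ s.active, ∃ B, s.best = some B ∧
    ∀ i, Discarded I ε B s.tree (v ++ [i])

theorem invariant_initial : Invariant I ε 0 (initial n m) where
  active_subset := subset_rfl
  length_le := by simp [initial]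
  eq_of_similar := by simp [initial]
  profile_le := by
    intro v hv i
    rw [Finset.mem_singleton.1 hv, I.profile_nil]
    positivity
  root_mem := Finset.mem_singleton_self _
  card_processed := by simp [initial]
  length_lt := by simp [initial]
  discarded := by simp [initial]

theorem length_lt_of_isFractional {v : Node m} {x : Fin n → Fin m → ℝ} (hx : x ∈ I.vertices v)
    {j : Fin n} (hj : IsFractional x j) : v.length < n := by
  obtain ⟨-, -, -, h4⟩ := I.mem_partialLP_iff.1 (extremePoints_subset hx)
  obtain ⟨i, hi, -⟩ := hj
  by_contra h
  exact hi (h4 j i fun h' => h ((I.mem_unfixed.1 h'.1).trans_lt j.2))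

/-- Processed nodes are those in the tree but not active. New children enter both sets, so `v` is
the only node that joins them. -/
theorem Invariant.expand (hε : 0 < ε) {k : ℕ} {s : State n m} (h : Invariant I ε k s)
    {v : Node m} (hv : v ∈ s.active) (hlen : v.length < n) (S : Schedule n m) :
    Invariant I ε (k + 1)
      { active := (expand I ε (better I s.best S) v s.active s.tree).1
        tree := (expand I ε (better I s.best S) v s.active s.tree).2
        best := some (better I s.best S)
        halted := False } := by
  classical
  have hq : TreeInvariant I ε (s.active.erase v) s.tree :=
    { h.toTreeInvariant with
      active_subset := (Finset.erase_subset _ _).trans h.active_subset }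
  have hfold := foldl_children hε (better I s.best S) hlen (List.finRange m)
    (s.active.erase v, s.tree) hq
  obtain ⟨h1, h2, h3, h4⟩ := hfold
  have hproc : s.tree \ s.active.erase v = insert v (s.tree \ s.active) := by
    ext w
    simp only [Finset.mem_sdiff, Finset.mem_erase, Finset.mem_insert]
    by_cases hw : w = v
    · simp [hw, h.active_subset hv]
    · simp [hw]
  have hmem : ∀ w ∈ (SimProf.expand I ε (better I s.best S) v s.active s.tree).2 \
      (SimProf.expand I ε (better I s.best S) v s.active s.tree).1,
      w = v ∨ w ∈ s.tree \ s.active := by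
    intro w hw
    have : w ∈ s.tree \ s.active.erase v := h3 ▸ hw
    rw [hproc] at this
    exact Finset.mem_insert.1 this
  refine { h1 with
    root_mem := h2 h.root_mem
    card_processed := ?_
    length_lt := fun w hw => ?_
    discarded := fun w hw => ⟨_, rfl, fun i => ?_⟩ }
  · refine (congrArg Finset.card (h3.trans hproc)).trans ?_
    rw [Finset.card_insert_of_notMem (by simp [hv]), h.card_processed]
  · rcases hmem w hw with rfl | hw
    · exact hlen
    · exact h.length_lt w hw
  · rcases hmem w hw with rfl | hw
    · exact h4 i (List.mem_finRange i)
    · obtain ⟨B, hB, hd⟩ := h.discarded w hw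
      refine (hd i).mono ?_ h2
      rw [hB]
      exact makespan_better_some_le B S

theorem Run.invariant (hε : 0 < ε) {k : ℕ} {s : State n m} (h : Run I ε k s)
    (hs : ¬ s.halted) : Invariant I ε k s := by
  induction h with
  | start => exact invariant_initial
  | @step k s s' _ hstep ih =>
    cases hstep with
    | integral => exact absurd trivial hs
    | branch v x y S running selected vertex fractional =>
      obtain ⟨j, hj⟩ := fractional
      exact (ih fun hh => running (Or.inl hh)).expand hε selected.1
        (length_lt_of_isFractional vertex hj) S

/-! ### Number of processed nodes -/

theorem Invariant.card_le (hn : 0 < n) (hε : 0 < ε) {k : ℕ} {s : State n m}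
    (h : Invariant I ε k s) :
    (k : ℝ) ≤ 1 + ((n : ℝ) - 1) * (3 * (n : ℝ) * (1 + ε) ^ 2 / ε) ^ m := by
  classical
  -- Depth 0 contributes only the root and is counted as 1 instead of a full grid; this saving pays
  -- for a final integral step.
  have hsub : s.tree \ s.active ⊆ insert [] ((Finset.Ico 1 n).biUnion fun d =>
      s.tree.filter fun v => v.length = d) := by
    intro v hv
    rw [Finset.mem_insert, Finset.mem_biUnion]
    rcases Nat.eq_zero_or_pos v.length with h0 | h0
    · exact Or.inl (List.eq_nil_of_length_eq_zero h0)
    · exact Or.inr ⟨v.length, Finset.mem_Ico.2 ⟨h0, h.length_lt v hv⟩,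
        Finset.mem_filter.2 ⟨(Finset.mem_sdiff.1 hv).1, rfl⟩⟩
  have hcard : k ≤ ∑ d ∈ Finset.Ico 1 n, (s.tree.filter fun v => v.length = d).card + 1 :=
    h.card_processed ▸ (Finset.card_le_card hsub).trans ((Finset.card_insert_le _ _).trans
      (Nat.add_le_add_right Finset.card_biUnion_le 1))
  have hlevel : ∀ d ∈ Finset.Ico 1 n, ((s.tree.filter fun v => v.length = d).card : ℝ) ≤
      (3 * (n : ℝ) * (1 + ε) ^ 2 / ε) ^ m := by
    intro d _
    refine I.card_le_of_pairwise_not_similar hn hε _ (fun v hv => ?_) fun u hu v hv => ?_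
    · exact h.profile_le v (Finset.mem_filter.1 hv).1
    · rw [Finset.mem_filter] at hu hv
      exact h.eq_of_similar u hu.1 v hv.1 (hu.2.trans hv.2.symm)
  have hsum := Finset.sum_le_card_nsmul _ _ _ hlevel
  rw [Nat.card_Ico, nsmul_eq_mul, Nat.cast_sub hn, Nat.cast_one] at hsum
  have hcard' : (k : ℝ) ≤
      ∑ d ∈ Finset.Ico 1 n, ((s.tree.filter fun v => v.length = d).card : ℝ) + 1 := by
    exact_mod_cast hcard
  linarith

theorem two_le_gridBound (hn : 0 < n) (hm : 0 < m) (hε : 0 < ε) :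
    2 ≤ (3 * (n : ℝ) * (1 + ε) ^ 2 / ε) ^ m := by
  have hn' : (1 : ℝ) ≤ n := by exact_mod_cast hn
  have hbase : (2 : ℝ) ≤ 3 * (n : ℝ) * (1 + ε) ^ 2 / ε := by
    rw [le_div_iff₀ hε]
    nlinarith [sq_nonneg ε, mul_nonneg (sub_nonneg.2 hn') (sq_nonneg (1 + ε))]
  exact hbase.trans (le_self_pow₀ (by linarith) hm.ne')

theorem Step.not_terminated {s s' : State n m} (h : Step I ε s s') : ¬ Terminated I ε s := by
  cases h with
  | integral _ _ _ running => exact running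
  | branch _ _ _ _ running => exact running

theorem Run.card_le (hn : 0 < n) (hm : 0 < m) (hε : 0 < ε) {k : ℕ} {s : State n m}
    (h : Run I ε k s) : (k : ℝ) ≤ (n : ℝ) * (3 * (n : ℝ) * (1 + ε) ^ 2 / ε) ^ m := by
  have hB := two_le_gridBound hn hm hε
  cases h with
  | start =>
    rw [Nat.cast_zero]
    positivity
  | @step k s₀ _ h hstep =>
    -- The last step may have halted, so the invariant is used one state earlier. With `G` the grid
    -- bound, `2 + (n - 1) * G ≤ n * G` because `2 ≤ G`.
    have := (h.invariant hε fun hh => hstep.not_terminated (Or.inl hh)).card_le hn hε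
    push_cast
    linarith

/-! ### Progress and the approximation guarantee -/

theorem exists_step (hm : 0 < m) {s : State n m} (hs : ¬ Terminated I ε s) :
    ∃ s', Step I ε s s' := by
  have hne : s.active.Nonempty := Finset.nonempty_iff_ne_empty.2 fun h => hs (Or.inr (Or.inl h))
  obtain ⟨v, hv, hmin⟩ := s.active.exists_min_image I.LB hne
  obtain ⟨x, hx⟩ := I.vertices_nonempty hm v
  by_cases hint : ∀ j, ¬ IsFractional x j
  · obtain ⟨S, hS⟩ := I.exists_isRounding hm hx
    exact ⟨_, Step.integral s v x S hs ⟨hv, hmin⟩ hx hint hS⟩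
  · have hfr : ∃ j, IsFractional x j := by simpa using hint
    obtain ⟨y, hy, hkeep, hlong⟩ : ∃ y ∈ I.vertices v, (LongestFractional v x → y = x) ∧
        (LongestFractional v y ∨ (y = x ∧ ∀ z ∈ I.vertices v, ¬ LongestFractional v z)) := by
      by_cases h1 : LongestFractional v x
      · exact ⟨x, hx, fun _ => rfl, Or.inl h1⟩
      · by_cases h2 : ∃ z ∈ I.vertices v, LongestFractional v z
        · obtain ⟨z, hz, hzl⟩ := h2
          exact ⟨z, hz, fun h => absurd h h1, Or.inl hzl⟩
        · exact ⟨x, hx, fun _ => rfl, Or.inr ⟨rfl, fun z hz hzl => h2 ⟨z, hz, hzl⟩⟩⟩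
    obtain ⟨S, hS⟩ := I.exists_isRounding hm hy
    exact ⟨_, Step.branch s v x y S hs ⟨hv, hmin⟩ hx hfr hy hkeep hlong hS⟩

/-- Completing `w` by the schedule `S` increases every completion time of `S` by at most `ε / n`
(in units of the lower bound of the root) for every job fixed at `w`. -/
def Follows (I : UniformInstance n m) (ε : ℝ) (S : Schedule n m) (w : Node m) : Prop :=
  ∀ i, (I.completion (UniformInstance.extend w S) i : ℝ) ≤
    I.completion S i + w.length * (ε / n * I.LB [])

theorem Follows.completion_le (hn : 0 < n) (hε : 0 < ε) {S : Schedule n m} {w : Node m}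
    (h : Follows I ε S w) (hw : w.length ≤ n) (i : Fin m) :
    (I.completion (UniformInstance.extend w S) i : ℝ) ≤ (1 + ε) * I.makespan S := by
  have hn' : (0 : ℝ) < n := Nat.cast_pos.2 hn
  have h1 : (I.completion S i : ℝ) ≤ I.makespan S := by
    exact_mod_cast I.completion_le_makespan S i
  have h2 : (I.LB [] : ℝ) ≤ I.makespan S := by exact_mod_cast I.LB_nil_le_makespan S
  have h3 : (w.length : ℝ) * (ε / n * I.LB []) ≤ ε * I.makespan S := by
    calc (w.length : ℝ) * (ε / n * I.LB []) ≤ n * (ε / n * I.LB []) := by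
          have : (w.length : ℝ) ≤ n := by exact_mod_cast hw
          gcongr
      _ = ε * I.LB [] := by field_simp
      _ ≤ ε * I.makespan S := by gcongr
  linarith [h i]

theorem Follows.LB_le (hn : 0 < n) (hm : 0 < m) (hε : 0 < ε) {S : Schedule n m} {w : Node m}
    (h : Follows I ε S w) (hw : w.length ≤ n) :
    (I.LB w : ℝ) ≤ (1 + ε) * I.makespan S := by
  have : Nonempty (Fin m) := ⟨⟨0, hm⟩⟩
  obtain ⟨i, -, hi⟩ := Finset.exists_mem_eq_sup Finset.univ Finset.univ_nonempty
    (I.completion (UniformInstance.extend w S))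
  have h1 : I.LB w ≤ I.completion (UniformInstance.extend w S) i :=
    (I.LB_le_makespan_extend w S).trans hi.le
  calc (I.LB w : ℝ) ≤ I.completion (UniformInstance.extend w S) i := by exact_mod_cast h1
    _ ≤ _ := h.completion_le hn hε hw i

theorem extend_append_singleton (S : Schedule n m) (w : Node m) (hw : w.length < n) :
    UniformInstance.extend (w ++ [S ⟨w.length, hw⟩]) S = UniformInstance.extend w S := by
  funext j
  unfold UniformInstance.extend
  rcases lt_trichotomy (j : ℕ) w.length with hj | hj | hj
  · rw [List.getElem?_append_left hj]
  · have : j = ⟨w.length, hw⟩ := Fin.ext hj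
    subst this
    simp
  · rw [List.getElem?_eq_none (by simpa using hj), List.getElem?_eq_none hj.le]

/-- Fixing the next job where `S` puts it leaves the completed schedule unchanged; only the
allowance grows. -/
theorem Follows.append {S : Schedule n m} {w : Node m} (hε : 0 < ε) (h : Follows I ε S w)
    (hw : w.length < n) : Follows I ε S (w ++ [S ⟨w.length, hw⟩]) := by
  intro i
  rw [extend_append_singleton, List.length_append, List.length_singleton]
  refine (h i).trans ?_
  have : (w.length : ℝ) ≤ (w.length + 1 : ℕ) := by exact_mod_cast Nat.le_succ _
  gcongr

/-- Passing from a child of a node that follows `S` to a similar node. -/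
theorem Follows.of_similar (hm : 0 < m) {S : Schedule n m} {w u : Node m}
    (h : Follows I ε S w) (hw : w.length < n)
    (hlen : u.length = (w ++ [S ⟨w.length, hw⟩]).length)
    (hs : I.Similar ε u (w ++ [S ⟨w.length, hw⟩])) : Follows I ε S u := by
  intro i
  set c := w ++ [S ⟨w.length, hw⟩] with hc
  -- Nodes of equal depth fix the same jobs, so `S` adds the same load to both; only their overheads
  -- differ.
  have hcomp : (I.completion (UniformInstance.extend u S) i : ℝ) - I.overhead u i =
      I.completion (UniformInstance.extend w S) i - I.overhead c i := by
    rw [← extend_append_singleton S w hw, I.completion_extend, I.completion_extend,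
      UniformInstance.unfixed, UniformInstance.unfixed, hlen]
    push_cast
    ring
  have hdiff : (I.overhead u i : ℝ) - I.overhead c i ≤ ε / n * I.LB [] := by
    rw [I.overhead_eq_profile_mul hm, I.overhead_eq_profile_mul hm, ← sub_mul]
    exact mul_le_mul_of_nonneg_right ((le_abs_self _).trans (hs i)) (Nat.cast_nonneg _)
  have hlen' : (u.length : ℝ) = w.length + 1 := by
    rw [hlen, hc, List.length_append, List.length_singleton]
    push_cast
    rfl
  rw [hlen']
  linarith [h i]

/-- In a state without integral vertex, either the best schedule is good already or there is an
active node of small lower bound. -/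
theorem Invariant.best_or_active (hn : 0 < n) (hm : 0 < m) (hε : 0 < ε) {k : ℕ}
    {s : State n m} (h : Invariant I ε k s) {S : Schedule n m}
    (hS : I.makespan S ≤ 2 * I.LB []) :
    (∃ B, s.best = some B ∧ (I.makespan B : ℝ) ≤ (1 + ε) * I.makespan S) ∨
      ∃ w ∈ s.active, (I.LB w : ℝ) ≤ (1 + ε) * I.makespan S := by
  classical
  have hroot : [] ∈ s.tree.filter (Follows I ε S) := by
    refine Finset.mem_filter.2 ⟨h.root_mem, fun i => ?_⟩
    simp [UniformInstance.extend_nil]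
  -- Maximal depth excludes the similarity case below: the similar node would follow `S` one level
  -- deeper.
  obtain ⟨w, hw, hmax⟩ := Finset.exists_max_image _ List.length ⟨_, hroot⟩
  obtain ⟨hwt, hwS⟩ := Finset.mem_filter.1 hw
  by_cases hact : w ∈ s.active
  · exact Or.inr ⟨w, hact, hwS.LB_le hn hm hε (h.length_le w hwt)⟩
  left
  have hproc := Finset.mem_sdiff.2 ⟨hwt, hact⟩
  have hlen := h.length_lt w hproc
  obtain ⟨B, hB, hd⟩ := h.discarded w hproc
  have hchild := hwS.append hε hlen
  have hchild_len : (w ++ [S ⟨w.length, hlen⟩]).length ≤ n := by simpa using hlen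
  refine ⟨B, hB, ?_⟩
  rcases hd (S ⟨w.length, hlen⟩) with hlt | ⟨i, hi⟩ | ⟨u, hu, hul, hus⟩
  · have : (I.makespan B : ℝ) ≤ I.LB (w ++ [S ⟨w.length, hlen⟩]) := by exact_mod_cast hlt.le
    exact this.trans (hchild.LB_le hn hm hε hchild_len)
  -- The overhead is at most `(1 + ε) * 2` root bounds, less than the cube's side; a zero root bound
  -- makes the profile 0.
  · exfalso
    have h1 : (I.overhead (w ++ [S ⟨w.length, hlen⟩]) i : ℝ) ≤ (1 + ε) * I.makespan S :=
      le_trans (by exact_mod_cast I.overhead_le_completion_extend _ S i)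
        (hchild.completion_le hn hε hchild_len i)
    have h2 : (I.makespan S : ℝ) ≤ 2 * I.LB [] := by exact_mod_cast hS
    rcases Nat.eq_zero_or_pos (I.LB []) with h0 | h0
    · rw [UniformInstance.profile, h0, Nat.cast_zero, div_zero] at hi
      exact absurd hi (not_lt.2 (by positivity))
    · have h0' : (0 : ℝ) < I.LB [] := Nat.cast_pos.2 h0
      rw [UniformInstance.profile, lt_div_iff₀ h0'] at hi
      have h3 : (1 + ε) * (I.makespan S : ℝ) ≤ (1 + ε) * (2 * I.LB []) := by gcongr
      nlinarith [mul_pos (mul_pos hε (by linarith : (0 : ℝ) < 1 + ε)) h0']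
  · have huS := hwS.of_similar hm hlen hul hus
    have := hmax u (Finset.mem_filter.2 ⟨hu, huS⟩)
    rw [hul, List.length_append, List.length_singleton] at this
    omega

theorem Run.best_le (hn : 0 < n) (hm : 0 < m) (hε : 0 < ε) {k : ℕ} {s : State n m}
    (h : Run I ε k s) (hs : Terminated I ε s) :
    ∃ B, s.best = some B ∧ ∀ S', (I.makespan B : ℝ) ≤ (1 + ε) ^ 2 * I.makespan S' := by
  obtain ⟨S, hopt, hS⟩ := I.exists_optimal_schedule hm
  have hsq : (1 + ε) * (I.makespan S : ℝ) ≤ (1 + ε) ^ 2 * I.makespan S := by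
    gcongr
    nlinarith
  suffices ∃ B, s.best = some B ∧ (I.makespan B : ℝ) ≤ (1 + ε) ^ 2 * I.makespan S by
    obtain ⟨B, hB, hle⟩ := this
    refine ⟨B, hB, fun S' => hle.trans ?_⟩
    have := hopt S'
    gcongr
  by_cases hh : s.halted
  · cases h with
    | start => exact hh.elim
    | @step k s₀ _ h hstep =>
      cases hstep with
      | branch => exact hh.elim
      | integral v x R running selected vertex integ rounding =>
        -- When halted, best-first selection bounds the integral schedule by the `LB` of any active
        -- node, so a single factor `1 + ε` suffices here.
        refine ⟨_, rfl, le_trans ?_ hsq⟩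
        have hinv := h.invariant hε fun hh => running (Or.inl hh)
        rcases hinv.best_or_active hn hm hε hS with ⟨B, hB, hle⟩ | ⟨w, hw, hle⟩
        · refine le_trans ?_ hle
          rw [hB]
          exact_mod_cast makespan_better_some_le B R
        · refine le_trans ?_ hle
          exact_mod_cast (makespan_better_le _ R).trans
            ((I.makespan_le_LB_of_integral vertex integ rounding).trans (selected.2 w hw))
  · have hinv := h.invariant hε hh
    rcases hinv.best_or_active hn hm hε hS with ⟨B, hB, hle⟩ | ⟨w, hw, hle⟩
    · exact ⟨B, hB, hle.trans hsq⟩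
    · rcases hs with hs | hs | ⟨B, hB, hs⟩
      · exact absurd hs hh
      · simp [hs] at hw
      · refine ⟨B, hB, (hs w hw).trans ?_⟩
        calc (1 + ε) * (I.LB w : ℝ) ≤ (1 + ε) * ((1 + ε) * I.makespan S) := by gcongr
          _ = _ := by ring

end SimProf

theorem theorem3 {n m : ℕ} (hn : 0 < n) (hm : 0 < m) (I : SimProf.UniformInstance n m)
    (ε : ℝ) (hε : 0 < ε) (σ : Equiv.Perm (Fin n)) (hσ : Antitone (I.p ∘ σ)) :
    (∀ (k : ℕ) (s : SimProf.State n m), SimProf.Run (I.reorder σ) ε k s →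
      (k : ℝ) ≤ (n : ℝ) * (3 * (n : ℝ) * (1 + ε) ^ 2 / ε) ^ m) ∧
    (∀ (k : ℕ) (s : SimProf.State n m), SimProf.Run (I.reorder σ) ε k s →
      ¬ SimProf.Terminated (I.reorder σ) ε s → ∃ s', SimProf.Step (I.reorder σ) ε s s') ∧
    (∀ (k : ℕ) (s : SimProf.State n m), SimProf.Run (I.reorder σ) ε k s →
      SimProf.Terminated (I.reorder σ) ε s →
      ∃ S : SimProf.Schedule n m, s.best = some S ∧
        ∀ S' : SimProf.Schedule n m,
          (I.makespan (S ∘ σ.symm) : ℝ) ≤ (1 + ε) ^ 2 * (I.makespan S' : ℝ)) := by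
  refine ⟨fun k s h => h.card_le hn hm hε, fun k s _ hs => SimProf.exists_step hm hs,
    fun k s h hs => ?_⟩
  obtain ⟨B, hB, hle⟩ := h.best_le hn hm hε hs
  refine ⟨B, hB, fun S' => ?_⟩
  have := hle (S' ∘ σ)
  rw [I.makespan_reorder, I.makespan_reorder] at this
  simpa [Function.comp_assoc] using this
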